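/- Let $\mathbb K$ be an ordinary differential field with derivation $\partial$, let $X=\{x_1,\dots,x_n\}$, $U=\{u_1,\dots,u_{n-1}\}$ be differential indeterminates, and write $y_k=\partial^k y$. Consider a system $x_i=P_i(U)$, $i=1,\dots,n$, where $P_i\in\mathbb K\{U\}$ have degree at most $1$, not all $P_i$ lie in $\mathbb K$, and every $u_j$ occurs (with some derivative) in at least one $P_i$. Its implicit ideal is $\mathrm{ID}=\{f\in\mathbb K\{X\}: f(P_1(U),\dots,P_n(U))=0\}$. Notation. $F_i=x_i-P_i(U)$; $a_i\in\mathbb K$ is the constant term of $P_i$; $\mathrm{ord}(F_i,u_j)$ is the order of $F_i$ in $u_j$, equal to $-1$ if no derivative of $u_j$ occurs; $o_i$ is the order of $F_i$ (equal to $0$ if $P_i\in\mathbb K$); $N=\sum_i o_i$; $\gamma_j=\min_i\,(o_i-\mathrm{ord}(F_i,u_j))$; $\gamma=\sum_{j=1}^{n-1}\gamma_j$. Let $\mathrm{PS}=\{\partial^kF_i: 1\le i\le n,\ 0\le k\le N-o_i-\gamma\}$, $\mathcal X=\{x_{ik}: 0\le k\le N-o_i-\gamma\}$, $\mathcal V=\{u_{jk}: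 0\le k\le N-\gamma_j-\gamma\}$, and let $(\mathrm{PS})$ be the ideal generated by $\mathrm{PS}$ in the polynomial ring $\mathbb K[\mathcal X][\mathcal V]$. The leading matrix $S$ is the $n\times(n-1)$ matrix whose $(i,j)$ entry is the coefficient in $F_i$ of the derivative of $u_{n-j}$ of order $o_i-\gamma_{n-j}$ (zero if this order is negative). Let $\mathcal G$ be the reduced Groebner basis of $(\mathrm{PS})$ for the lexicographic monomial order induced by the following order $\mathcal R^\star$ of the derivatives: every $x_{ik}$ is smaller than every $u_{jl}$; $x_{ik}<x_{i'k'}$ if $i>i'$, or $i=i'$ and $k<k'$; $u_{jk}<u_{j'k'}$ if $k<k'$, or $k=k'$ and $j<j'$. Put $\mathcal G_0=\mathcal G\cap\mathbb K\{X\}$, and let $(\mathcal G_0)$ be the ideal it generates in $\mathbb K[\mathcal X]$. For a nonzero linear (that is, of degree at most $1$) $A\in(\mathcal G_0)$ the co-order $\mathrm c(A)$ is the largest $c\ge 0$ with $\partial^cA\in(\mathrm{PS})$. Such an $A$ lies in $\mathrm{ID}$ and is of the form $A=\sum_i\mathcal F_i(x_i-a_i)$ with $\mathcal F_i\in\mathbb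 K[\partial]$; it is called $\mathrm{ID}$-primitive if the greatest common left divisor of $\mathcal F_1,\dots,\mathcal F_n$ is in $\mathbb K$. For a ranking on $X$, a characteristic set of $\mathrm{ID}$ is an autoreduced subset $\mathcal C$ of $\mathrm{ID}$ such that no nonzero element of $\mathrm{ID}$ is reduced with respect to $\mathcal C$; the (differential) dimension of $\mathrm{ID}$ is $n-|\mathcal C|$. A characteristic polynomial of $\mathrm{ID}$ is an irreducible $A$ such that $\{A\}$ is a characteristic set of $\mathrm{ID}$. Theorem. Assume $\mathrm{rank}(S)=n-1$. Then every nonzero linear $\mathrm{ID}$-primitive $A\in(\mathcal G_0)$ with $|\mathcal G_0|=\mathrm c(A)+1$ is a characteristic polynomial of $\mathrm{ID}$ (with respect to every ranking on $X$), and hence $\dim\mathrm{ID}=n-1$. -/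

import Mathlib

open scoped Differential

noncomputable section

namespace LinearDPPE

/-! ### Differential polynomials -/

/-- The ring `K{Y}` of differential polynomials in the differential indeterminates `Y`.
The variable `(y, k)` is the `k`-th derivative of `y`. -/
abbrev DiffPoly (Y : Type*) (K : Type*) [CommSemiring K] := MvPolynomial (Y × ℕ) K

section Basic

variable {Y K : Type*} [Field K] [Differential K]

/-- Apply the derivation of `K` to every coefficient. -/
def coeffDeriv : DiffPoly Y K →+ DiffPoly Y K where
  toFun p := ∑ m ∈ p.support, MvPolynomial.monomial m ((p.coeff m)′)
  map_zero' := by simp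
  map_add' p q := by
    classical
    have key : ∀ (r : DiffPoly Y K) (m : Y × ℕ →₀ ℕ),
        MvPolynomial.coeff m (∑ e ∈ r.support, MvPolynomial.monomial e ((r.coeff e)′))
          = (r.coeff m)′ := by
      intro r m
      rw [MvPolynomial.coeff_sum]
      simp only [MvPolynomial.coeff_monomial]
      rw [Finset.sum_ite_eq' r.support m]
      split_ifs with h
      · rfl
      · rw [MvPolynomial.notMem_support_iff.mp h, map_zero]
    ext m
    rw [MvPolynomial.coeff_add, key, key, key, MvPolynomial.coeff_add, map_add]

theorem coeff_coeffDeriv (p : DiffPoly Y K) (m : Y × ℕ →₀ ℕ) :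
    MvPolynomial.coeff m (coeffDeriv p) = (p.coeff m)′ := by
  classical
  change MvPolynomial.coeff m (∑ e ∈ p.support, MvPolynomial.monomial e ((p.coeff e)′)) = _
  rw [MvPolynomial.coeff_sum]
  simp only [MvPolynomial.coeff_monomial]
  rw [Finset.sum_ite_eq' p.support m]
  split_ifs with h
  · rfl
  · rw [MvPolynomial.notMem_support_iff.mp h, map_zero]

theorem coeffDeriv_mul (p q : DiffPoly Y K) :
    coeffDeriv (p * q) = p * coeffDeriv q + q * coeffDeriv p := by
  classical
  ext m
  rw [coeff_coeffDeriv, MvPolynomial.coeff_add, mul_comm q, MvPolynomial.coeff_mul,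
    MvPolynomial.coeff_mul, MvPolynomial.coeff_mul, map_sum, ← Finset.sum_add_distrib]
  refine Finset.sum_congr rfl fun e _ => ?_
  rw [coeff_coeffDeriv, coeff_coeffDeriv, Derivation.leibniz, smul_eq_mul, smul_eq_mul]
  ring

/-- The derivation `∂` of `K{Y}`: it extends the derivation of `K` and sends the variable
`(y, k)` to `(y, k + 1)`. -/
def diff : Derivation ℤ (DiffPoly Y K) (DiffPoly Y K) :=
  Derivation.mk'
    ((coeffDeriv (Y := Y) (K := K) +
      (MvPolynomial.mkDerivation K
        (fun v : Y × ℕ => (MvPolynomial.X (v.1, v.2 + 1) : DiffPoly Y K))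
          ).toLinearMap.toAddMonoidHom).toIntLinearMap)
    (by
      intro a b
      simp only [AddMonoidHom.coe_toIntLinearMap, AddMonoidHom.add_apply, coeffDeriv_mul,
        LinearMap.toAddMonoidHom_coe, Derivation.coeFn_coe,
        Derivation.leibniz, smul_eq_mul]
      ring)

theorem diff_C (c : K) : diff (MvPolynomial.C c : DiffPoly Y K) = MvPolynomial.C (c′) := by
  classical
  change coeffDeriv (MvPolynomial.C c : DiffPoly Y K) +
    MvPolynomial.mkDerivation K _ (MvPolynomial.C c) = _
  rw [MvPolynomial.derivation_C, add_zero]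
  ext m
  rw [coeff_coeffDeriv, MvPolynomial.coeff_C, MvPolynomial.coeff_C]
  split_ifs <;> simp

theorem diff_X (v : Y × ℕ) :
    diff (MvPolynomial.X v : DiffPoly Y K) = MvPolynomial.X (v.1, v.2 + 1) := by
  classical
  change coeffDeriv (MvPolynomial.X v : DiffPoly Y K) +
    MvPolynomial.mkDerivation K _ (MvPolynomial.X v) = _
  rw [MvPolynomial.mkDerivation_X]
  convert zero_add _
  ext m
  rw [coeff_coeffDeriv, MvPolynomial.coeff_X]
  split_ifs <;> simp

/-- `ord(p, y)`: the largest `k` such that the `k`-th derivative of `y` occurs in `p`,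
and `-1` if no derivative of `y` occurs. -/
def ord [DecidableEq Y] (p : DiffPoly Y K) (y : Y) : ℤ :=
  (((p.vars.filter fun v => v.1 = y).sup fun v => v.2 + 1 : ℕ) : ℤ) - 1

/-- The coefficient in `p` of (the first power of) the `d`-th derivative of `y`; it is `0` for
`d < 0`, where there is no such derivative. -/
def linCoeff (p : DiffPoly Y K) (y : Y) (d : ℤ) : K :=
  if 0 ≤ d then p.coeff (Finsupp.single (y, d.toNat) 1) else 0

/-- The ring `K[∂]` of linear differential operators, acting on `K{Y}`: the subring of the additive
endomorphisms of `K{Y}` generated by `∂` and by the multiplications by elements of `K`.  Its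
elements are the operators `∑ cₖ ∂ᵏ`, and for nonempty `Y` the `cₖ` are unique
(apply the operator to an indeterminate). -/
def diffOps (Y K : Type*) [Field K] [Differential K] : Subring (AddMonoid.End (DiffPoly Y K)) :=
  Subring.closure
    ({(diff (Y := Y) (K := K)).toLinearMap.toAddMonoidHom} ∪
      Set.range fun c : K => AddMonoidHom.mulLeft (MvPolynomial.C c : DiffPoly Y K))

/-- An element of `K` as a differential operator of order zero. -/
def constOp (c : K) : diffOps Y K :=
  ⟨AddMonoidHom.mulLeft (MvPolynomial.C c), Subring.subset_closure (Or.inr ⟨c, rfl⟩)⟩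

/-- `D` is a greatest common left divisor of the family `F`
(`a ∣ b` means `b = a * c` for some `c`). -/
def IsGCLD {ι M : Type*} [Monoid M] (D : M) (F : ι → M) : Prop :=
  (∀ i, D ∣ F i) ∧ ∀ E, (∀ i, E ∣ F i) → E ∣ D

end Basic

/-! ### Rankings and characteristic sets -/

section Ranking

variable {Y K : Type*} [Field K]

/-- `r v w` (read `v < w`) is a ranking of the derivatives of the indeterminates `Y`. -/
structure IsRanking (r : Y × ℕ → Y × ℕ → Prop) : Prop where
  irrefl : ∀ v, ¬ r v v
  trans : ∀ u v w, r u v → r v w → r u w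
  total : ∀ v w, r v w ∨ v = w ∨ r w v
  lt_deriv : ∀ v, r v (v.1, v.2 + 1)
  deriv_lt_deriv : ∀ v w, r v w → r (v.1, v.2 + 1) (w.1, w.2 + 1)

/-- `v` is the lead of `p`: the highest derivative present in `p`. -/
def IsLead (r : Y × ℕ → Y × ℕ → Prop) (p : DiffPoly Y K) (v : Y × ℕ) : Prop :=
  v ∈ p.vars ∧ ∀ w ∈ p.vars, w ≠ v → r w v

/-- `q` is reduced with respect to `p`: no proper derivative of the lead of `p` is present in `q`,
and the degree of `q` in the lead of `p` is smaller than that of `p`. -/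
def IsReduced (r : Y × ℕ → Y × ℕ → Prop) (q p : DiffPoly Y K) : Prop :=
  ∃ v, IsLead r p v ∧ (∀ k, 0 < k → (v.1, v.2 + k) ∉ q.vars) ∧
    q.degreeOf v < p.degreeOf v

/-- `C` is a characteristic set of `I`: an autoreduced subset of `I` (its elements are not in `K`,
and each one is reduced with respect to all the others) such that no nonzero element of `I` is
reduced with respect to all elements of `C`. -/
def IsCharacteristicSet (r : Y × ℕ → Y × ℕ → Prop) (I : Ideal (DiffPoly Y K))
    (C : Set (DiffPoly Y K)) : Prop :=
  (∀ p ∈ C, p ∈ I ∧ p.vars.Nonempty) ∧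
  (∀ p ∈ C, ∀ q ∈ C, q ≠ p → IsReduced r q p) ∧
  ∀ f ∈ I, f ≠ 0 → ¬ ∀ p ∈ C, IsReduced r f p

/-- `I` has (differential) dimension `d`: characteristic sets of `I` exist, and `|Y| - |C| = d` for
each of them. -/
def HasDimension [Fintype Y] (r : Y × ℕ → Y × ℕ → Prop) (I : Ideal (DiffPoly Y K)) (d : ℕ) :
    Prop :=
  (∃ C, IsCharacteristicSet r I C) ∧
    ∀ C, IsCharacteristicSet r I C → C.encard + (d : ℕ∞) = (Fintype.card Y : ℕ∞)

/-- `A` is a characteristic polynomial of `I`: an irreducible differential polynomial such that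
`{A}` is a characteristic set of `I`. -/
def IsCharacteristicPolynomial (r : Y × ℕ → Y × ℕ → Prop)
    (I : Ideal (DiffPoly Y K)) (A : DiffPoly Y K) : Prop :=
  Irreducible A ∧ IsCharacteristicSet r I {A}

end Ranking

/-! ### Reduced Groebner bases for a lexicographic monomial order -/

section Groebner

variable {σ K : Type*} [Field K]

/-- The lexicographic order of monomials induced by an order `r` of the variables. -/
def LexLT (r : σ → σ → Prop) (e f : σ →₀ ℕ) : Prop :=
  ∃ v, e v < f v ∧ ∀ w, r v w → e w = f w

/-- `e` is (the exponent of) the leading monomial of `p`. -/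
def IsLeadMon (r : σ → σ → Prop) (p : MvPolynomial σ K) (e : σ →₀ ℕ) : Prop :=
  e ∈ p.support ∧ ∀ f ∈ p.support, f ≠ e → LexLT r f e

/-- The ideal generated by `T` in the polynomial ring `K[V]` in a set `V` of the variables, for
`T` contained in `K[V]`. -/
def idealIn (V : Set σ) (T : Set (MvPolynomial σ K)) : Set (MvPolynomial σ K) :=
  Subtype.val ''
    ((Ideal.span (Subtype.val ⁻¹' T) : Ideal (MvPolynomial.supported K V)) :
      Set (MvPolynomial.supported K V))

/-- `G` is the reduced Groebner basis of the ideal `I` with respect to the lexicographic monomial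
order induced by `r`. -/
structure IsReducedGroebnerBasis (r : σ → σ → Prop) (I G : Set (MvPolynomial σ K)) : Prop where
  finite : G.Finite
  subset : G ⊆ I
  monic : ∀ g ∈ G, ∃ e, IsLeadMon r g e ∧ g.coeff e = 1
  lead : ∀ f ∈ I, f ≠ 0 → ∃ g ∈ G, ∃ e e', IsLeadMon r g e ∧ IsLeadMon r f e' ∧ e ≤ e'
  reduced : ∀ g ∈ G, ∀ h ∈ G, h ≠ g → ∀ e, IsLeadMon r h e → ∀ m ∈ g.support, ¬ e ≤ m

end Groebner

/-! ### Systems of linear differential polynomial parametric equations -/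

/-- A system `x₁ = P₁(U), …, xₙ = Pₙ(U)` of linear DPPEs in the parameters `u₁, …, uₙ₋₁`. -/
structure DPPESystem (n : ℕ) (K : Type*) [Field K] [Differential K] where
  /-- the right-hand sides `Pᵢ` -/
  P : Fin n → DiffPoly (Fin (n - 1)) K
  degree_le : ∀ i, (P i).totalDegree ≤ 1
  not_all_const : ∃ i, P i ∉ Set.range (MvPolynomial.C (R := K) (σ := Fin (n - 1) × ℕ))
  occurs : ∀ j, ∃ i, 0 ≤ ord (P i) j

namespace DPPESystem

variable {n : ℕ} {K : Type*} [Field K] [Differential K] (E : DPPESystem n K)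

/-- Substitution of `Pᵢ(U)` for `xᵢ`, as a map `K{X} → K{U}`. -/
def subst : DiffPoly (Fin n) K →ₐ[K] DiffPoly (Fin (n - 1)) K :=
  MvPolynomial.aeval fun v => diff^[v.2] (E.P v.1)

/-- The implicit ideal `ID` of the system. -/
def implicitIdeal : Ideal (DiffPoly (Fin n) K) := RingHom.ker E.subst

/-- The inclusion of `K{X}` into `K{X ∪ U}`. -/
def inclX : DiffPoly (Fin n) K →ₐ[K] DiffPoly (Fin n ⊕ Fin (n - 1)) K :=
  MvPolynomial.rename (Prod.map Sum.inl id)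

/-- The inclusion of `K{U}` into `K{X ∪ U}`. -/
def inclU : DiffPoly (Fin (n - 1)) K →ₐ[K] DiffPoly (Fin n ⊕ Fin (n - 1)) K :=
  MvPolynomial.rename (Prod.map Sum.inr id)

/-- `Fᵢ = xᵢ - Pᵢ(U)`. -/
def F (i : Fin n) : DiffPoly (Fin n ⊕ Fin (n - 1)) K :=
  MvPolynomial.X (Sum.inl i, 0) - inclU (E.P i)

/-- `aᵢ`, the part of `Pᵢ` in `K`. -/
def a (i : Fin n) : K := MvPolynomial.constantCoeff (E.P i)

/-- The order `oᵢ` of `Fᵢ` (which is `0` if `Pᵢ ∈ K`). -/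
def o (i : Fin n) : ℤ := ((E.F i).vars.sup fun v => v.2 : ℕ)

/-- `N = o₁ + ⋯ + oₙ`. -/
def N : ℤ := ∑ i, E.o i

/-- `γⱼ`, the minimum over `i` of `oᵢ - ord(Fᵢ, uⱼ)`. -/
def gammaAt (j : Fin (n - 1)) : ℤ := ⨅ i, E.o i - ord (E.F i) (Sum.inr j)

/-- The completeness index `γ`. -/
def gamma : ℤ := ∑ j, E.gammaAt j

/-- The set `PS` of the `∂ᵏ Fᵢ` with `0 ≤ k ≤ N - oᵢ - γ`. -/
def PS : Set (DiffPoly (Fin n ⊕ Fin (n - 1)) K) :=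
  {f | ∃ (i : Fin n) (k : ℕ), (k : ℤ) ≤ E.N - E.o i - E.gamma ∧ f = diff^[k] (E.F i)}

/-- The derivatives `xᵢₖ` with `0 ≤ k ≤ N - oᵢ - γ`. -/
def varsX : Set (Fin n × ℕ) := {v | (v.2 : ℤ) ≤ E.N - E.o v.1 - E.gamma}

/-- The derivatives `uⱼₖ` with `0 ≤ k ≤ N - γⱼ - γ`. -/
def varsU : Set (Fin (n - 1) × ℕ) := {v | (v.2 : ℤ) ≤ E.N - E.gammaAt v.1 - E.gamma}

/-- The ideal `(PS)` generated by `PS` in the polynomial ring in the variables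
`varsX` and `varsU`, as a subset of `K{X ∪ U}`. -/
def idealPS : Set (DiffPoly (Fin n ⊕ Fin (n - 1)) K) :=
  idealIn (Prod.map Sum.inl id '' E.varsX ∪ Prod.map Sum.inr id '' E.varsU) E.PS

/-- The leading matrix `S`: its entry `(i, j)` is the coefficient in `Fᵢ` of the derivative of
`uₙ₋ⱼ` of order `oᵢ - γₙ₋ⱼ`. -/
def S : Matrix (Fin n) (Fin (n - 1)) K :=
  Matrix.of fun i j => linCoeff (E.F i) (Sum.inr j.rev) (E.o i - E.gammaAt j.rev)

/-- The ranking `ℛ*`: every derivative of an `x` is below every derivative of a `u`; the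
derivatives of the `x` are ranked by elimination with `xₙ < ⋯ < x₁`, those of the `u` are ranked
orderly with `u₁ < ⋯ < uₙ₋₁`. -/
def rankingStar : (Fin n ⊕ Fin (n - 1)) × ℕ → (Fin n ⊕ Fin (n - 1)) × ℕ → Prop
  | (Sum.inl i, k), (Sum.inl i', k') => i' < i ∨ (i = i' ∧ k < k')
  | (Sum.inl _, _), (Sum.inr _, _) => True
  | (Sum.inr _, _), (Sum.inl _, _) => False
  | (Sum.inr j, k), (Sum.inr j', k') => k < k' ∨ (k = k' ∧ j < j')

/-- `𝒢` is the Groebner basis associated to the system. -/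
def IsGroebnerBasis (𝒢 : Set (DiffPoly (Fin n ⊕ Fin (n - 1)) K)) : Prop :=
  IsReducedGroebnerBasis rankingStar E.idealPS 𝒢

/-- `𝒢 ∩ K{X}`, as a subset of `K{X}`. -/
def interX (𝒢 : Set (DiffPoly (Fin n ⊕ Fin (n - 1)) K)) : Set (DiffPoly (Fin n) K) :=
  inclX ⁻¹' 𝒢

/-- The co-order `c(B)` of `B` in `(PS)`: the largest `c` with `∂ᶜ B ∈ (PS)`. -/
def coorder (B : DiffPoly (Fin n ⊕ Fin (n - 1)) K) : ℕ := sSup {c | diff^[c] B ∈ E.idealPS}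

/-- `B ∈ ID` is `ID`-primitive: `B = ∑ Tᵢ (xᵢ - aᵢ)` with differential operators `Tᵢ` whose
greatest common left divisor is in `K`. -/
def IsIDPrimitive (B : DiffPoly (Fin n) K) : Prop :=
  B ∈ E.implicitIdeal ∧ ∃ T : Fin n → diffOps (Fin n) K,
    B = ∑ i, (T i : AddMonoid.End (DiffPoly (Fin n) K))
      (MvPolynomial.X (i, 0) - MvPolynomial.C (E.a i)) ∧
    ∃ c : K, IsGCLD (constOp c) T

end DPPESystem

end LinearDPPE

end

noncomputable section

namespace LinearDPPE

open MvPolynomial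

/-! ### Linear differential operators in normal form -/

section Operators

/-! Write `H i` for the degree-one part of `Pᵢ`. A linear form `∑ tᵢ (xᵢ - aᵢ)` lies in `ID` exactly
when `∑ tᵢ (H i) = 0`, so the linear elements of this form correspond to a left `K[∂]`-module of
relations. The argument shows that a primitive `A` generates this module and then passes from linear
to arbitrary elements of `ID`.

Give the `i`-th component of a relation the weight `oᵢ`. Since `Fᵢ` has order at most `oᵢ - γⱼ` in
`uⱼ`, the top-weight coefficients of a relation form a vector in the left kernel of `S`
(`leadVec_vecMul_S`). If `S` has rank `n - 1`, this kernel is a line, so division by a nonzero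
relation `b` of least weight leaves no remainder, and `b` generates all relations
(`exists_generator`). If `A` corresponds to `a = Q b`, then `Q` is a common left divisor of the
components of `a`. Primitivity makes `Q` a nonzero constant, so `a` is a generator as well
(`IsIDPrimitive.exists_eq_linForm`).

Let `v` be the lead of `A`. A nonzero multiple of `a` involves a derivative of `v`, so the
derivatives of the `H i` not indexed by derivatives of `v` are linearly independent over `K`. A
linear change of the `u`-variables then recovers the remaining `x`-variables from their images, so
an element of `ID` free of the derivatives of `v` vanishes (`eq_zero_of_mem_implicitIdeal`). Hence
`{A}` is a characteristic set, and comparing leads shows that every characteristic set has one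
element. -/

theorem end_add_apply {M : Type*} [AddCommMonoid M] (f g : AddMonoid.End M) (x : M) :
    (f + g) x = f x + g x := rfl

theorem end_mul_apply {M : Type*} [AddCommMonoid M] (f g : AddMonoid.End M) (x : M) :
    (f * g) x = f (g x) := rfl

theorem end_ext {M : Type*} [AddCommMonoid M] {f g : AddMonoid.End M} (h : ∀ x, f x = g x) :
    f = g := AddMonoidHom.ext h

theorem coeff_single_C {R σ : Type*} [CommSemiring R] (v : σ) (a : R) :
    coeff (Finsupp.single v 1) (C a : MvPolynomial σ R) = 0 := by
  classical
  rw [coeff_C, if_neg]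
  rw [eq_comm, Finsupp.single_eq_zero]
  exact one_ne_zero

variable {Y K : Type*} [Field K]

/-- Multiplication by a constant. -/
def mulEnd (Y : Type*) {K : Type*} [Field K] (c : K) : AddMonoid.End (DiffPoly Y K) :=
  AddMonoidHom.mulLeft (C c)

@[simp]
theorem mulEnd_apply (c : K) (p : DiffPoly Y K) : mulEnd Y c p = C c * p := rfl

theorem mulEnd_zero : mulEnd Y (0 : K) = 0 := by
  ext p
  simp

theorem mulEnd_add (a b : K) : mulEnd Y (a + b) = mulEnd Y a + mulEnd Y b := by
  refine end_ext fun p => ?_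
  simp [end_add_apply, add_mul]

theorem mulEnd_mul (a b : K) : mulEnd Y (a * b) = mulEnd Y a * mulEnd Y b := by
  refine end_ext fun p => ?_
  simp [end_mul_apply, mul_assoc]

variable [Differential K]

/-- The additive endomorphism of `K{Y}` given by the derivation. -/
def diffEnd (Y K : Type*) [Field K] [Differential K] : AddMonoid.End (DiffPoly Y K) :=
  (diff (Y := Y) (K := K)).toLinearMap.toAddMonoidHom

@[simp]
theorem diffEnd_apply (p : DiffPoly Y K) : diffEnd Y K p = diff p := rfl

theorem diffEnd_pow_apply (k : ℕ) (p : DiffPoly Y K) : (diffEnd Y K ^ k) p = diff^[k] p := by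
  rw [AddMonoid.End.coe_pow]
  rfl

theorem diff_C_mul (c : K) (p : DiffPoly Y K) :
    diff (C c * p) = C (c′) * p + C c * diff p := by
  rw [Derivation.leibniz, diff_C, smul_eq_mul, smul_eq_mul]
  ring

theorem iterate_diff_C (k : ℕ) (c : K) :
    diff^[k] (C c : DiffPoly Y K) = C (Differential.deriv^[k] c) := by
  induction k with
  | zero => rfl
  | succ k ih => rw [Function.iterate_succ_apply', ih, diff_C, Function.iterate_succ_apply']

theorem iterate_diff_X (k : ℕ) (y : Y) :
    diff^[k] (X (y, 0) : DiffPoly Y K) = X (y, k) := by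
  induction k with
  | zero => rfl
  | succ k ih => rw [Function.iterate_succ_apply', ih, diff_X]

theorem iterate_diff_add (k : ℕ) (p q : DiffPoly Y K) :
    diff^[k] (p + q) = diff^[k] p + diff^[k] q := by
  rw [← diffEnd_pow_apply, map_add, diffEnd_pow_apply, diffEnd_pow_apply]

/-- The operator `∑ qₖ ∂ᵏ` with coefficients those of `q`. -/
def op (Y : Type*) {K : Type*} [Field K] [Differential K] (q : Polynomial K) :
    AddMonoid.End (DiffPoly Y K) :=
  q.sum fun k c => mulEnd Y c * diffEnd Y K ^ k

theorem op_add (p q : Polynomial K) : op Y (p + q) = op Y p + op Y q := by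
  refine Polynomial.sum_add_index _ _ _ ?_ ?_
  · intro k
    rw [mulEnd_zero, zero_mul]
  · intro k a b
    rw [mulEnd_add, add_mul]

theorem op_monomial (k : ℕ) (c : K) :
    op Y (Polynomial.monomial k c) = mulEnd Y c * diffEnd Y K ^ k := by
  refine Polynomial.sum_monomial_index _ _ ?_
  rw [mulEnd_zero, zero_mul]

theorem op_zero : op Y (0 : Polynomial K) = 0 := Polynomial.sum_zero_index _

theorem op_C (c : K) : op Y (Polynomial.C c) = mulEnd Y c := by
  rw [← Polynomial.monomial_zero_left, op_monomial, pow_zero, mul_one]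

theorem op_neg (p : Polynomial K) : op Y (-p) = -op Y p := by
  rw [eq_neg_iff_add_eq_zero, ← op_add, neg_add_cancel, op_zero]

theorem op_C_mul (c : K) (q : Polynomial K) : op Y (Polynomial.C c * q) = mulEnd Y c * op Y q := by
  induction q using Polynomial.induction_on' with
  | add p q hp hq => rw [mul_add, op_add, hp, hq, op_add, mul_add]
  | monomial k a => rw [Polynomial.C_mul_monomial, op_monomial, op_monomial, mulEnd_mul, mul_assoc]

theorem op_apply (q : Polynomial K) (p : DiffPoly Y K) :
    op Y q p = q.sum fun k c => C c * diff^[k] p := by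
  induction q using Polynomial.induction_on' with
  | add f g hf hg =>
    rw [op_add, end_add_apply, hf, hg, Polynomial.sum_add_index]
    · simp
    · simp [add_mul]
  | monomial k a =>
    rw [op_monomial, end_mul_apply, mulEnd_apply, diffEnd_pow_apply,
      Polynomial.sum_monomial_index]
    simp

/-- Left multiplication by `∂` on coefficient sequences of operators. -/
def opDeriv : Polynomial K →+ Polynomial K :=
  AddMonoidHom.mulLeft Polynomial.X +
    (Differential.mapCoeffs (A := K)).toLinearMap.toAddMonoidHom

theorem opDeriv_apply (q : Polynomial K) :
    opDeriv q = Polynomial.X * q + Differential.mapCoeffs q := rfl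

theorem opDeriv_monomial (k : ℕ) (c : K) :
    opDeriv (Polynomial.monomial k c) =
      Polynomial.monomial (k + 1) c + Polynomial.monomial k (c′) := by
  rw [opDeriv_apply, Differential.mapCoeffs_monomial, Polynomial.X_mul_monomial]

theorem coeff_opDeriv_succ (q : Polynomial K) (k : ℕ) :
    (opDeriv q).coeff (k + 1) = q.coeff k + (q.coeff (k + 1))′ := by
  rw [opDeriv_apply, Polynomial.coeff_add, Polynomial.coeff_X_mul, Differential.coeff_mapCoeffs]

theorem op_opDeriv (q : Polynomial K) : op Y (opDeriv q) = diffEnd Y K * op Y q := by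
  induction q using Polynomial.induction_on' with
  | add f g hf hg => rw [map_add, op_add, hf, hg, op_add, mul_add]
  | monomial k a =>
    rw [opDeriv_monomial, op_add, op_monomial, op_monomial, op_monomial]
    refine end_ext fun p => ?_
    rw [end_add_apply]
    simp only [end_mul_apply, mulEnd_apply, diffEnd_pow_apply, diffEnd_apply, diff_C_mul,
      Function.iterate_succ_apply']
    ring

theorem op_iterate_opDeriv (k : ℕ) (q : Polynomial K) :
    op Y (opDeriv^[k] q) = diffEnd Y K ^ k * op Y q := by
  induction k with
  | zero => rw [pow_zero, one_mul]; rfl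
  | succ k ih => rw [Function.iterate_succ_apply', op_opDeriv, ih, pow_succ', mul_assoc]

/-- The coefficients of the composition of two operators. -/
def opMul (Q q : Polynomial K) : Polynomial K :=
  Q.sum fun k c => Polynomial.C c * opDeriv^[k] q

theorem opMul_zero_left (q : Polynomial K) : opMul 0 q = 0 := Polynomial.sum_zero_index _

theorem opMul_add_left (P Q q : Polynomial K) : opMul (P + Q) q = opMul P q + opMul Q q := by
  refine Polynomial.sum_add_index _ _ _ ?_ ?_
  · simp
  · simp [add_mul]

theorem opMul_monomial (k : ℕ) (c : K) (q : Polynomial K) :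
    opMul (Polynomial.monomial k c) q = Polynomial.C c * opDeriv^[k] q := by
  refine Polynomial.sum_monomial_index _ _ ?_
  simp

theorem opMul_C (c : K) (q : Polynomial K) : opMul (Polynomial.C c) q = Polynomial.C c * q := by
  rw [← Polynomial.monomial_zero_left, opMul_monomial]
  rfl

theorem op_opMul (Q q : Polynomial K) : op Y (opMul Q q) = op Y Q * op Y q := by
  induction Q using Polynomial.induction_on' with
  | add f g hf hg => rw [opMul_add_left, op_add, hf, hg, op_add, add_mul]
  | monomial k a =>
    rw [opMul_monomial, op_C_mul, op_iterate_opDeriv, op_monomial, mul_assoc]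

/-! ### Degrees and leading coefficients of composed operators. -/

theorem coeff_iterate_opDeriv_of_lt {q : Polynomial K} {m : ℕ} (hq : ∀ j, m < j → q.coeff j = 0)
    (k : ℕ) : ∀ j, m + k < j → (opDeriv^[k] q).coeff j = 0 := by
  induction k with
  | zero => simpa using hq
  | succ k ih =>
    intro j hj
    obtain ⟨j, rfl⟩ : ∃ i, j = i + 1 := ⟨j - 1, by omega⟩
    rw [Function.iterate_succ_apply', coeff_opDeriv_succ, ih _ (by omega), ih _ (by omega)]
    simp

theorem coeff_iterate_opDeriv {q : Polynomial K} {m : ℕ} (hq : ∀ j, m < j → q.coeff j = 0)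
    (k : ℕ) : (opDeriv^[k] q).coeff (m + k) = q.coeff m := by
  induction k with
  | zero => rfl
  | succ k ih =>
    rw [Function.iterate_succ_apply', ← add_assoc, coeff_opDeriv_succ, ih,
      coeff_iterate_opDeriv_of_lt hq k _ (by omega)]
    simp

/-- Commuting `∂` past a coefficient `c` only adds the lower-order term `c′`, so the top
coefficients multiply as for ordinary polynomials. Additivity of degrees and the absence of zero
divisors follow. -/
theorem coeff_opMul {q : Polynomial K} {m : ℕ} (hq : ∀ j, m < j → q.coeff j = 0)
    (Q : Polynomial K) :
    (opMul Q q).coeff (m + Q.natDegree) = Q.leadingCoeff * q.coeff m := by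
  rw [opMul, Polynomial.sum_def, Polynomial.finsetSum_coeff,
    Finset.sum_eq_single Q.natDegree]
  · rw [Polynomial.coeff_C_mul, coeff_iterate_opDeriv hq, Polynomial.leadingCoeff]
  · intro k hk hne
    have := Polynomial.le_natDegree_of_mem_supp k hk
    rw [Polynomial.coeff_C_mul, coeff_iterate_opDeriv_of_lt hq k _ (by omega), mul_zero]
  · intro h
    rw [Polynomial.notMem_support_iff.mp h, Polynomial.C_0, zero_mul, Polynomial.coeff_zero]

theorem natDegree_eq_zero_of_opMul_eq_C {Q R : Polynomial K} {c : K} (hc : c ≠ 0)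
    (h : opMul Q R = Polynomial.C c) : Q.natDegree = 0 := by
  have hQ : Q ≠ 0 := by
    rintro rfl
    rw [opMul_zero_left] at h
    exact hc (Polynomial.C_eq_zero.mp h.symm)
  have hR : R ≠ 0 := by
    rintro rfl
    have : opMul Q (0 : Polynomial K) = 0 := by
      simp [opMul, Polynomial.sum_def, iterate_map_zero]
    rw [this] at h
    exact hc (Polynomial.C_eq_zero.mp h.symm)
  have key := coeff_opMul (q := R) (m := R.natDegree)
    (fun j hj => Polynomial.coeff_eq_zero_of_natDegree_lt hj) Q
  by_contra hne
  rw [h, Polynomial.coeff_C, if_neg (by omega)] at key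
  exact mul_ne_zero (Polynomial.leadingCoeff_ne_zero.mpr hQ)
    (Polynomial.leadingCoeff_ne_zero.mpr hR) key.symm

theorem op_X_sub_C (q : Polynomial K) (y : Y) (a : K) :
    ∃ b : K, op Y q (X (y, 0) - C a) = (q.sum fun k c => C c * X (y, k)) + C b := by
  induction q using Polynomial.induction_on' with
  | add f g hf hg =>
    obtain ⟨b, hb⟩ := hf
    obtain ⟨b', hb'⟩ := hg
    refine ⟨b + b', ?_⟩
    rw [op_add, end_add_apply, hb, hb', Polynomial.sum_add_index, map_add]
    · ring
    · simp
    · simp [add_mul]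
  | monomial k c =>
    refine ⟨-(c * Differential.deriv^[k] a), ?_⟩
    rw [op_monomial, end_mul_apply, mulEnd_apply, Polynomial.sum_monomial_index,
      map_sub, diffEnd_pow_apply, diffEnd_pow_apply, iterate_diff_C, iterate_diff_X]
    · simp only [C_neg, C_mul]
      ring
    · simp

theorem coeff_op_X_sub_C [DecidableEq Y] (q : Polynomial K) (y z : Y) (a : K) (k : ℕ) :
    coeff (Finsupp.single (z, k) 1) (op Y q (X (y, 0) - C a)) =
      if y = z then q.coeff k else 0 := by
  obtain ⟨b, hb⟩ := op_X_sub_C q y a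
  rw [hb, coeff_add, coeff_single_C, add_zero, Polynomial.sum_def, coeff_sum]
  simp only [coeff_C_mul, coeff_X, Finsupp.single_left_inj (one_ne_zero' ℕ), Prod.mk.injEq,
    mul_ite, mul_one, mul_zero]
  split_ifs with h
  · simp only [h, true_and, Finset.sum_ite_eq']
    split_ifs with h'
    · rfl
    · exact (Polynomial.notMem_support_iff.mp h').symm
  · simp [h]

/-- Applying the operator to one indeterminate exhibits its coefficients. Identities for `opMul` can
therefore be transferred from composition of endomorphisms. -/
theorem op_injective [Nonempty Y] : Function.Injective (op Y : Polynomial K → _) := by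
  classical
  intro p q h
  ext k
  obtain ⟨y⟩ := ‹Nonempty Y›
  have := coeff_op_X_sub_C p y y (0 : K) k
  rw [h, coeff_op_X_sub_C] at this
  simpa using this.symm

theorem opMul_assoc [Nonempty Y] (P Q R : Polynomial K) :
    opMul (opMul P Q) R = opMul P (opMul Q R) := by
  apply op_injective (Y := Y)
  rw [op_opMul, op_opMul, op_opMul, op_opMul, mul_assoc]

theorem op_mem_diffOps (q : Polynomial K) : op Y q ∈ diffOps Y K := by
  refine Subring.sum_mem _ fun k _ => Subring.mul_mem _ ?_ (Subring.pow_mem _ ?_ _)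
  · exact Subring.subset_closure (Or.inr ⟨_, rfl⟩)
  · exact Subring.subset_closure (Or.inl rfl)

/-- The normal forms `∑ cₖ ∂ᵏ` contain the generators and are closed under the ring operations,
composition being `opMul`. Operators can thus be replaced by their coefficient sequences. -/
theorem exists_op_eq {T : AddMonoid.End (DiffPoly Y K)} (hT : T ∈ diffOps Y K) :
    ∃ q, op Y q = T := by
  have h1 : op Y (1 : Polynomial K) = 1 := by
    rw [← Polynomial.C_1, op_C]
    ext p
    simp
  induction hT using Subring.closure_induction with
  | mem x hx =>
    rcases hx with rfl | ⟨c, rfl⟩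
    · refine ⟨opDeriv 1, ?_⟩
      rw [op_opDeriv, h1, mul_one]
      rfl
    · exact ⟨Polynomial.C c, op_C c⟩
  | zero => exact ⟨0, op_zero⟩
  | one => exact ⟨1, h1⟩
  | add x y _ _ hx hy =>
    obtain ⟨p, rfl⟩ := hx
    obtain ⟨q, rfl⟩ := hy
    exact ⟨p + q, op_add p q⟩
  | neg x _ hx =>
    obtain ⟨p, rfl⟩ := hx
    exact ⟨-p, op_neg p⟩
  | mul x y _ _ hx hy =>
    obtain ⟨p, rfl⟩ := hx
    obtain ⟨q, rfl⟩ := hy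
    exact ⟨opMul p q, op_opMul p q⟩

end Operators

/-! ### Linear coefficients of derivatives -/

section LinCoeff

variable {Y K : Type*} [Field K]

theorem linCoeff_natCast (p : DiffPoly Y K) (y : Y) (d : ℕ) :
    linCoeff p y d = coeff (Finsupp.single (y, d) 1) p := by
  simp [linCoeff]

theorem linCoeff_of_neg (p : DiffPoly Y K) (y : Y) {d : ℤ} (hd : d < 0) : linCoeff p y d = 0 :=
  if_neg (by omega)

theorem linCoeff_sum {ι : Type*} (s : Finset ι) (p : ι → DiffPoly Y K) (y : Y) (d : ℤ) :
    linCoeff (∑ i ∈ s, p i) y d = ∑ i ∈ s, linCoeff (p i) y d := by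
  unfold linCoeff
  split_ifs <;> simp [coeff_sum]

theorem linCoeff_C_mul (c : K) (p : DiffPoly Y K) (y : Y) (d : ℤ) :
    linCoeff (C c * p) y d = c * linCoeff p y d := by
  unfold linCoeff
  split_ifs <;> simp

theorem coeff_single_mul_X [DecidableEq Y] (p : DiffPoly Y K) (v w : Y × ℕ) :
    coeff (Finsupp.single w 1) (p * X v) = if v = w then constantCoeff p else 0 := by
  classical
  rw [coeff_mul_X']
  by_cases h : v = w
  · subst h
    simp [constantCoeff_eq]
  · simp [h]

variable [Differential K]

theorem constantCoeff_diff (p : DiffPoly Y K) :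
    constantCoeff (diff p) = (constantCoeff p)′ := by
  induction p using MvPolynomial.induction_on with
  | C a => rw [diff_C, constantCoeff_C, constantCoeff_C]
  | add p q hp hq => simp only [map_add, hp, hq]
  | mul_X p v _ =>
    rw [Derivation.leibniz, diff_X]
    simp

/-- Valid for all `p`, not only linear ones: the linear coefficients of `p * X v` depend only on the
constant term of `p`, so the product step needs no induction hypothesis. -/
theorem coeff_diff_single_succ (p : DiffPoly Y K) (y : Y) (d : ℕ) :
    coeff (Finsupp.single (y, d + 1) 1) (diff p) =
      coeff (Finsupp.single (y, d) 1) p + (coeff (Finsupp.single (y, d + 1) 1) p)′ := by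
  classical
  induction p using MvPolynomial.induction_on with
  | C a => simp only [diff_C, coeff_single_C, map_zero, add_zero]
  | add p q hp hq =>
    simp only [map_add, coeff_add, hp, hq]
    ring
  | mul_X p v _ =>
    rw [Derivation.leibniz, diff_X, smul_eq_mul, smul_eq_mul, mul_comm (X v), coeff_add]
    simp only [coeff_single_mul_X, constantCoeff_diff]
    obtain ⟨z, e⟩ := v
    simp only [Prod.mk.injEq, add_left_inj]
    congr 1
    split_ifs <;> simp

theorem coeff_diff_single_zero (p : DiffPoly Y K) (y : Y) :
    coeff (Finsupp.single (y, 0) 1) (diff p) = (coeff (Finsupp.single (y, 0) 1) p)′ := by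
  classical
  induction p using MvPolynomial.induction_on with
  | C a => simp only [diff_C, coeff_single_C, map_zero]
  | add p q hp hq => simp only [map_add, coeff_add, hp, hq]
  | mul_X p v _ =>
    rw [Derivation.leibniz, diff_X, smul_eq_mul, smul_eq_mul, mul_comm (X v), coeff_add]
    simp only [coeff_single_mul_X, constantCoeff_diff]
    obtain ⟨z, e⟩ := v
    simp only [Prod.mk.injEq, Nat.succ_ne_zero, and_false, if_false, zero_add]
    split_ifs <;> simp

/-- Integer orders are used because `oᵢ - γⱼ` may be negative. The case `d = -1` is the coefficient
of the underived indeterminate, which receives nothing from below. -/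
theorem linCoeff_diff (p : DiffPoly Y K) (y : Y) (d : ℤ) :
    linCoeff (diff p) y (d + 1) = linCoeff p y d + (linCoeff p y (d + 1))′ := by
  rcases lt_trichotomy d (-1) with h | rfl | h
  · rw [linCoeff_of_neg _ _ (by omega), linCoeff_of_neg _ _ (by omega),
      linCoeff_of_neg _ _ (by omega)]
    simp
  · rw [linCoeff_of_neg p _ (d := -1) (by omega)]
    have := coeff_diff_single_zero p y
    simpa [linCoeff] using this
  · lift d to ℕ using by omega
    have := coeff_diff_single_succ p y d
    rw [← linCoeff_natCast, ← linCoeff_natCast, ← linCoeff_natCast] at this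
    exact_mod_cast this

theorem linCoeff_iterate_diff_of_lt {p : DiffPoly Y K} {y : Y} {e : ℤ}
    (hp : ∀ d, e < d → linCoeff p y d = 0) (k : ℕ) :
    ∀ d, e + k < d → linCoeff (diff^[k] p) y d = 0 := by
  induction k with
  | zero => simpa using hp
  | succ k ih =>
    intro d hd
    push_cast at hd
    rw [Function.iterate_succ_apply', ← sub_add_cancel d 1, linCoeff_diff, ih _ (by omega),
      ih _ (by omega)]
    simp

theorem linCoeff_iterate_diff {p : DiffPoly Y K} {y : Y} {e : ℤ}
    (hp : ∀ d, e < d → linCoeff p y d = 0) (k : ℕ) :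
    linCoeff (diff^[k] p) y (e + k) = linCoeff p y e := by
  induction k with
  | zero => simp
  | succ k ih =>
    rw [Function.iterate_succ_apply', Nat.cast_succ, ← add_assoc, linCoeff_diff, ih,
      linCoeff_iterate_diff_of_lt hp k _ (by omega)]
    simp

theorem linCoeff_op {p : DiffPoly Y K} {y : Y} {e : ℤ}
    (hp : ∀ d, e < d → linCoeff p y d = 0) {q : Polynomial K} {s : ℕ}
    (hq : ∀ k, s < k → q.coeff k = 0) :
    linCoeff (op Y q p) y (e + s) = q.coeff s * linCoeff p y e := by
  rw [op_apply, Polynomial.sum_def, linCoeff_sum, Finset.sum_eq_single s]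
  · rw [linCoeff_C_mul, linCoeff_iterate_diff hp]
  · intro k hk hne
    have : k ≤ s := by
      by_contra hlt
      exact Polynomial.mem_support_iff.mp hk (hq k (by omega))
    rw [linCoeff_C_mul, linCoeff_iterate_diff_of_lt hp k _ (by omega), mul_zero]
  · intro h
    rw [Polynomial.notMem_support_iff.mp h, C_0, zero_mul]
    simp [linCoeff]

end LinCoeff

end LinearDPPE

end

noncomputable section

namespace LinearDPPE

open MvPolynomial

theorem linCoeff_eq_zero_of_ord_lt {Y K : Type*} [Field K] [DecidableEq Y] {p : DiffPoly Y K} {y : Y} {d : ℤ}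
    (h : ord p y < d) : linCoeff p y d = 0 := by
  by_contra hne
  rw [linCoeff] at hne
  split_ifs at hne with hd
  · have hv : (y, d.toNat) ∈ p.vars :=
      (mem_vars_iff_mem_support _).mpr ⟨_, mem_support_iff.mpr hne, by simp⟩
    have := Finset.le_sup (f := fun v : Y × ℕ => v.2 + 1)
      (Finset.mem_filter.mpr ⟨hv, rfl⟩ : (y, d.toNat) ∈ p.vars.filter fun v => v.1 = y)
    unfold ord at h
    simp only at this
    omega
  · exact hne rfl

namespace DPPESystem

variable {n : ℕ} {K : Type*} [Field K] [Differential K] (E : DPPESystem n K)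

/-! ### Relations between the homogeneous parts -/

/-- The part of degree one of `Pᵢ`. -/
def H (i : Fin n) : DiffPoly (Fin (n - 1)) K := E.P i - C (E.a i)

theorem subst_X (v : Fin n × ℕ) : E.subst (X v) = diff^[v.2] (E.P v.1) := aeval_X _ _

theorem subst_C (c : K) : E.subst (C c) = C c := E.subst.commutes c

theorem subst_diff (p : DiffPoly (Fin n) K) : E.subst (diff p) = diff (E.subst p) := by
  induction p using MvPolynomial.induction_on with
  | C a => rw [diff_C, subst_C, subst_C, diff_C]
  | add p q hp hq => rw [map_add, map_add, hp, hq, map_add, map_add]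
  | mul_X p v hp =>
    rw [Derivation.leibniz, smul_eq_mul, smul_eq_mul, map_add, map_mul, map_mul, hp, diff_X,
      map_mul, Derivation.leibniz, subst_X, subst_X, smul_eq_mul, smul_eq_mul,
      Function.iterate_succ_apply']

theorem subst_iterate_diff (k : ℕ) (p : DiffPoly (Fin n) K) :
    E.subst (diff^[k] p) = diff^[k] (E.subst p) := by
  induction k with
  | zero => rfl
  | succ k ih => rw [Function.iterate_succ_apply', subst_diff, ih, Function.iterate_succ_apply']

theorem subst_op (q : Polynomial K) (p : DiffPoly (Fin n) K) :
    E.subst (op _ q p) = op _ q (E.subst p) := by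
  rw [op_apply, op_apply, Polynomial.sum_def, Polynomial.sum_def, map_sum]
  refine Finset.sum_congr rfl fun k _ => ?_
  rw [map_mul, subst_C, subst_iterate_diff]

theorem subst_X_sub_C (i : Fin n) : E.subst (X (i, 0) - C (E.a i)) = E.H i := by
  rw [map_sub, subst_X, subst_C]
  rfl

/-- The element `∑ tᵢ (xᵢ - aᵢ)`. -/
def linForm (t : Fin n → Polynomial K) : DiffPoly (Fin n) K :=
  ∑ i, op _ (t i) (X (i, 0) - C (E.a i))

theorem coeff_linForm (t : Fin n → Polynomial K) (v : Fin n × ℕ) :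
    coeff (Finsupp.single v 1) (E.linForm t) = (t v.1).coeff v.2 := by
  obtain ⟨i, k⟩ := v
  rw [linForm, coeff_sum]
  simp only [coeff_op_X_sub_C]
  simp

/-- `t` is a linear relation between the homogeneous parts of the `Pᵢ`. -/
def IsRelation (t : Fin n → Polynomial K) : Prop := ∑ i, op _ (t i) (E.H i) = 0

/-- Substitution commutes with `∂` and sends `xᵢ - aᵢ` to `H i`. -/
theorem linForm_mem_implicitIdeal {t : Fin n → Polynomial K} :
    E.linForm t ∈ E.implicitIdeal ↔ E.IsRelation t := by
  change E.subst (E.linForm t) = 0 ↔ _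
  rw [linForm, map_sum]
  simp only [subst_op, subst_X_sub_C]
  rfl

variable {E}

theorem IsRelation.opMul {t : Fin n → Polynomial K} (ht : E.IsRelation t) (Q : Polynomial K) :
    E.IsRelation fun i => opMul Q (t i) := by
  unfold IsRelation at *
  simp only [op_opMul, end_mul_apply]
  rw [← map_sum, ht, map_zero]

theorem IsRelation.add {s t : Fin n → Polynomial K} (hs : E.IsRelation s) (ht : E.IsRelation t) :
    E.IsRelation (s + t) := by
  unfold IsRelation at *
  simp only [Pi.add_apply, op_add, end_add_apply]
  rw [Finset.sum_add_distrib, hs, ht, add_zero]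

variable (E)

/-! ### The leading matrix -/

/-- The order of `Fᵢ` as a natural number. -/
def oNat (i : Fin n) : ℕ := (E.F i).vars.sup fun v => v.2

theorem o_eq (i : Fin n) : E.o i = E.oNat i := rfl

theorem ord_le_o_sub_gammaAt (i : Fin n) (j : Fin (n - 1)) :
    ord (E.F i) (Sum.inr j) ≤ E.o i - E.gammaAt j := by
  have : E.gammaAt j ≤ E.o i - ord (E.F i) (Sum.inr j) :=
    ciInf_le (Set.finite_range _).bddBelow i
  omega

theorem coeff_F (i : Fin n) (j : Fin (n - 1)) (d : ℕ) :
    coeff (Finsupp.single (Sum.inr j, d) 1) (E.F i) = -coeff (Finsupp.single (j, d) 1) (E.H i) := by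
  have hinj : Function.Injective
      (Prod.map Sum.inr id : Fin (n - 1) × ℕ → (Fin n ⊕ Fin (n - 1)) × ℕ) :=
    Sum.inr_injective.prodMap Function.injective_id
  have h := coeff_rename_mapDomain _ hinj (E.P i) (Finsupp.single (j, d) 1)
  rw [Finsupp.mapDomain_single] at h
  change coeff (Finsupp.single (Sum.inr j, d) 1) (inclU (E.P i)) = _ at h
  rw [F, H, coeff_sub, coeff_sub, coeff_single_C, h, coeff_X, if_neg]
  · ring
  · rw [Finsupp.single_left_inj one_ne_zero]
    simp

theorem linCoeff_F (i : Fin n) (j : Fin (n - 1)) (d : ℤ) :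
    linCoeff (E.F i) (Sum.inr j) d = -linCoeff (E.H i) j d := by
  unfold linCoeff
  split_ifs
  · exact E.coeff_F i j _
  · simp

theorem linCoeff_H_of_lt (i : Fin n) (j : Fin (n - 1)) (d : ℤ) (hd : E.o i - E.gammaAt j < d) :
    linCoeff (E.H i) j d = 0 := by
  have := linCoeff_eq_zero_of_ord_lt ((E.ord_le_o_sub_gammaAt i j).trans_lt hd)
  rwa [linCoeff_F, neg_eq_zero] at this

/-- `t` has weighted degree smaller than `d`, the weight of the `i`-th component being `oᵢ`. -/
def WeightLT (d : ℕ) (t : Fin n → Polynomial K) : Prop :=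
  ∀ i k, d ≤ k + E.oNat i → (t i).coeff k = 0

/-- The coefficients of `t` of weighted degree `d`. -/
def leadVec (d : ℕ) (t : Fin n → Polynomial K) (i : Fin n) : K :=
  if E.oNat i ≤ d then (t i).coeff (d - E.oNat i) else 0

/-- Compare coefficients of the derivative of `uⱼ` of order `d - γⱼ` in the relation. By definition
of `γⱼ` this is the highest order that weight `d` allows, so each component contributes only its top
coefficient times an entry of `S`, up to sign. -/
theorem leadVec_vecMul_S {t : Fin n → Polynomial K} (ht : E.IsRelation t) {d : ℕ}
    (hd : E.WeightLT (d + 1) t) : Matrix.vecMul (E.leadVec d t) E.S = 0 := by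
  ext j
  have h := congrArg (fun p => linCoeff p j.rev (d - E.gammaAt j.rev)) ht
  simp only [linCoeff_sum] at h
  have h0 : linCoeff (0 : DiffPoly (Fin (n - 1)) K) j.rev (d - E.gammaAt j.rev) = 0 := by
    simp [linCoeff]
  rw [h0] at h
  rw [Pi.zero_apply, Matrix.vecMul, dotProduct, ← neg_eq_zero, ← Finset.sum_neg_distrib, ← h]
  refine Finset.sum_congr rfl fun i _ => ?_
  have hSij : E.S i j = -linCoeff (E.H i) j.rev (E.o i - E.gammaAt j.rev) := E.linCoeff_F i _ _
  rw [hSij, leadVec]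
  split_ifs with hi
  · have hop := linCoeff_op (E.linCoeff_H_of_lt i j.rev) (q := t i) (s := d - E.oNat i)
      (fun k hk => hd i k (by omega))
    have hidx : E.o i - E.gammaAt j.rev + ((d - E.oNat i : ℕ) : ℤ) = d - E.gammaAt j.rev := by
      rw [o_eq, Nat.cast_sub hi]
      ring
    rw [hidx] at hop
    rw [hop]
    ring
  · have : t i = 0 := Polynomial.ext fun k => hd i k (by omega)
    rw [this, op_zero, zero_mul, neg_zero]
    simp [linCoeff]

/-- The left kernel of `S` has dimension `n - (n - 1) = 1`; here `n > 0` because some `Pᵢ` exists.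
-/
theorem vecMul_S_proportional (hS : E.S.rank = n - 1) {w w' : Fin n → K} (hw0 : w ≠ 0)
    (hw : Matrix.vecMul w E.S = 0) (hw' : Matrix.vecMul w' E.S = 0) : ∃ c : K, w' = c • w := by
  have hn : 0 < n := by
    obtain ⟨i, -⟩ := E.not_all_const
    exact i.pos
  have hrank : Module.finrank K (LinearMap.range E.S.vecMulLinear) = n - 1 := by
    refine Eq.trans ?_ hS
    rw [← Matrix.rank_transpose, Matrix.rank, Matrix.mulVecLin_transpose]
  have hker := LinearMap.finrank_range_add_finrank_ker E.S.vecMulLinear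
  rw [hrank, Module.finrank_fintype_fun_eq_card, Fintype.card_fin] at hker
  have h1 : Module.finrank K (LinearMap.ker E.S.vecMulLinear) = 1 := by omega
  obtain ⟨c, hc⟩ := (finrank_eq_one_iff_of_nonzero' (⟨w, hw⟩ : LinearMap.ker E.S.vecMulLinear)
    (by simpa [Subtype.ext_iff] using hw0)).mp h1 ⟨w', hw'⟩
  exact ⟨c, (congrArg Subtype.val hc).symm⟩

theorem WeightLT.of_leadVec_eq_zero {t : Fin n → Polynomial K} {d : ℕ}
    (hd : E.WeightLT (d + 1) t) (h : E.leadVec d t = 0) : E.WeightLT d t := by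
  intro i k hk
  rcases hk.eq_or_lt with heq | hlt
  · have := congrFun h i
    rw [leadVec, if_pos (by omega)] at this
    rwa [show k = d - E.oNat i by omega]
  · exact hd i k hlt

theorem exists_weightLT (t : Fin n → Polynomial K) : ∃ d, E.WeightLT d t := by
  refine ⟨(∑ i, ((t i).natDegree + E.oNat i)) + 1, fun i k hk => ?_⟩
  apply Polynomial.coeff_eq_zero_of_natDegree_lt
  have := Finset.single_le_sum (f := fun i => (t i).natDegree + E.oNat i)
    (fun _ _ => Nat.zero_le _) (Finset.mem_univ i)
  omega

theorem eq_zero_of_weightLT_zero {t : Fin n → Polynomial K} (h : E.WeightLT 0 t) : t = 0 := by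
  ext i k
  exact h i k (Nat.zero_le _)

/-- The relations form a cyclic module over the differential operators. -/
theorem exists_generator (hS : E.S.rank = n - 1) {t₀ : Fin n → Polynomial K} (h₀ : t₀ ≠ 0)
    (ht₀ : E.IsRelation t₀) :
    ∃ b, E.IsRelation b ∧ ∀ t, E.IsRelation t → ∃ Q, t = fun i => opMul Q (b i) := by
  classical
  -- Choose `b` nonzero of least weight; the least strict bound is `d + 1`, so `b` has weight
  -- exactly `d` and a nonzero leading vector.
  have hex : ∃ d, ∃ t, t ≠ 0 ∧ E.IsRelation t ∧ E.WeightLT d t := by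
    obtain ⟨d, hd⟩ := E.exists_weightLT t₀
    exact ⟨d, t₀, h₀, ht₀, hd⟩
  obtain ⟨b, hb0, hb, hbd⟩ := Nat.find_spec hex
  have hmin := fun m => Nat.find_min hex (m := m)
  obtain ⟨d, hd⟩ : ∃ d, Nat.find hex = d + 1 := by
    refine Nat.exists_eq_succ_of_ne_zero fun h => hb0 ?_
    rw [h] at hbd
    exact E.eq_zero_of_weightLT_zero hbd
  rw [hd] at hbd
  simp only [hd] at hmin
  have hlead : E.leadVec d b ≠ 0 := fun h =>
    hmin d (by omega) ⟨b, hb0, hb, hbd.of_leadVec_eq_zero E h⟩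
  refine ⟨b, hb, ?_⟩
  have main : ∀ m t, E.IsRelation t → E.WeightLT m t →
      ∃ Q, t = fun i => LinearDPPE.opMul Q (b i) := by
    intro m
    induction m with
    | zero =>
      intro t _ htm
      exact ⟨0, by rw [E.eq_zero_of_weightLT_zero htm]; ext1 i; rw [opMul_zero_left]; rfl⟩
    | succ m ih =>
      intro t ht htm
      by_cases hm : m < d
      · have : t = 0 := by
          by_contra hne
          exact hmin (m + 1) (by omega) ⟨t, hne, ht, htm⟩
        exact ⟨0, by rw [this]; ext1 i; rw [opMul_zero_left]; rfl⟩
      · have hcoef : ∀ i j, d - E.oNat i < j → (b i).coeff j = 0 := by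
          intro i j hj
          exact hbd i j (by omega)
        -- Both leading vectors lie on the same line, so subtracting `c ∂^(m-d) b` from `t` cancels
        -- its part of weight `m`. Components with `oᵢ > d` vanish in `b` and must be treated apart
        -- because of truncated subtraction.
        obtain ⟨c, hc⟩ := E.vecMul_S_proportional hS hlead (E.leadVec_vecMul_S hb hbd)
          (E.leadVec_vecMul_S ht htm)
        have hs : E.IsRelation fun i =>
            LinearDPPE.opMul (Polynomial.monomial (m - d) (-c)) (b i) := hb.opMul _
        have hbz : ∀ i, ¬ E.oNat i ≤ d → b i = 0 := fun i hi =>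
          Polynomial.ext fun k => hbd i k (by omega)
        have hit : ∀ i, ¬ E.oNat i ≤ d → opDeriv^[m - d] (b i) = 0 := fun i hi => by
          rw [hbz i hi, iterate_map_zero]
        obtain ⟨Q, hQ⟩ := ih _ (ht.add hs) (by
          apply WeightLT.of_leadVec_eq_zero
          · intro i k hk
            rw [Pi.add_apply, Polynomial.coeff_add, htm i k hk, opMul_monomial,
              Polynomial.coeff_C_mul, zero_add]
            by_cases hi : E.oNat i ≤ d
            · rw [coeff_iterate_opDeriv_of_lt (hcoef i) _ _ (by omega), mul_zero]
            · rw [hit i hi, Polynomial.coeff_zero, mul_zero]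
          · ext i
            have hci := congrFun hc i
            rw [Pi.smul_apply, smul_eq_mul] at hci
            simp only [leadVec] at hci ⊢
            by_cases hi : E.oNat i ≤ d
            · rw [if_pos (by omega), if_pos hi] at hci
              rw [if_pos (by omega), Pi.add_apply, Polynomial.coeff_add, hci, opMul_monomial,
                Polynomial.coeff_C_mul,
                show m - E.oNat i = d - E.oNat i + (m - d) by omega,
                coeff_iterate_opDeriv (hcoef i), Pi.zero_apply]
              ring
            · rw [if_neg hi, mul_zero] at hci
              simp only [Pi.add_apply, opMul_monomial, hit i hi, mul_zero, add_zero]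
              exact hci)
        refine ⟨Q + Polynomial.monomial (m - d) c, ?_⟩
        ext1 i
        have := congrFun hQ i
        rw [Pi.add_apply] at this
        rw [opMul_add_left, ← this, add_assoc, ← opMul_add_left, ← map_add, neg_add_cancel,
          map_zero, opMul_zero_left, add_zero]
  intro t ht
  obtain ⟨m, hm⟩ := E.exists_weightLT t
  exact main m t ht hm

/-- An `ID`-primitive linear form generates the module of relations. -/
theorem IsIDPrimitive.exists_eq_linForm (hS : E.S.rank = n - 1) {A : DiffPoly (Fin n) K}
    (hA : E.IsIDPrimitive A) (hA0 : A ≠ 0) :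
    ∃ a, A = E.linForm a ∧ ∀ t, E.IsRelation t → ∃ Q, t = fun i => LinearDPPE.opMul Q (a i) := by
  obtain ⟨hAI, T, hAT, c, hcT, hgcd⟩ := hA
  have : Nonempty (Fin n) := ⟨E.not_all_const.choose⟩
  choose a ha using fun i => exists_op_eq (T i).2
  have hAa : A = E.linForm a := by
    rw [hAT, linForm]
    exact Finset.sum_congr rfl fun i _ => by rw [ha i]
  refine ⟨a, hAa, ?_⟩
  have hrel : E.IsRelation a := E.linForm_mem_implicitIdeal.mp (hAa ▸ hAI)
  have hz : E.linForm 0 = 0 :=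
    Finset.sum_eq_zero fun i _ => by rw [Pi.zero_apply, op_zero]; rfl
  have ha0 : a ≠ 0 := by
    rintro rfl
    exact hA0 (hAa.trans hz)
  obtain ⟨b, -, hgen⟩ := E.exists_generator hS ha0 hrel
  obtain ⟨Q, hQ⟩ := hgen a hrel
  -- Zero divides only zero, so `c = 0` would force `a = 0`.
  have hc : c ≠ 0 := by
    rintro rfl
    apply ha0
    ext1 i
    obtain ⟨R, hR⟩ := hcT i
    apply op_injective (Y := Fin n)
    rw [ha i, hR, Pi.zero_apply, op_zero]
    refine end_ext fun p => ?_
    change C 0 * (R : AddMonoid.End (DiffPoly (Fin n) K)) p = 0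
    rw [C_0, zero_mul]
  -- From `a = Q b`, the operator `Q` divides every component on the left, hence divides the
  -- constant `c`; by degrees it is itself a constant.
  obtain ⟨R, hR⟩ := hgcd ⟨op _ Q, op_mem_diffOps Q⟩ fun i =>
    ⟨⟨op _ (b i), op_mem_diffOps _⟩, Subtype.ext (by
      rw [← ha i, congrFun hQ i, op_opMul]
      rfl)⟩
  obtain ⟨q, hq⟩ := exists_op_eq R.2
  have hQq : LinearDPPE.opMul Q q = Polynomial.C c := by
    apply op_injective (Y := Fin n)
    rw [op_opMul, op_C, hq]
    exact (congrArg Subtype.val hR).symm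
  obtain ⟨u, rfl⟩ := Polynomial.natDegree_eq_zero.mp (natDegree_eq_zero_of_opMul_eq_C hc hQq)
  have hu : u ≠ 0 := by
    rintro rfl
    rw [Polynomial.C_0, opMul_zero_left] at hQq
    exact hc (Polynomial.C_eq_zero.mp hQq.symm)
  intro t ht
  obtain ⟨Q', hQ'⟩ := hgen t ht
  refine ⟨LinearDPPE.opMul Q' (Polynomial.C u⁻¹), ?_⟩
  ext1 i
  rw [hQ', congrFun hQ i, opMul_assoc (Y := Fin n), opMul_C, opMul_C, ← mul_assoc, ← Polynomial.C_mul,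
    inv_mul_cancel₀ hu, Polynomial.C_1, one_mul]

end DPPESystem

end LinearDPPE

end

noncomputable section

namespace LinearDPPE

open MvPolynomial

/-! ### Polynomials of degree at most one -/

section DegreeOne

variable {σ K : Type*} [Field K]

theorem eq_single_of_degree_le_one {m : σ →₀ ℕ} (hm : (m.sum fun _ e => e) ≤ 1) {v : σ}
    (hv : v ∈ m.support) : m = Finsupp.single v 1 := by
  classical
  have hv' := Finsupp.mem_support_iff.mp hv
  have hsum : m v + ∑ w ∈ m.support.erase v, m w ≤ 1 := by
    rw [Finset.add_sum_erase _ _ hv]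
    exact hm
  ext w
  rw [Finsupp.single_apply]
  split_ifs with h
  · subst h
    omega
  · by_contra hne
    have := Finset.single_le_sum (f := m) (fun _ _ => Nat.zero_le _)
      (Finset.mem_erase.mpr ⟨Ne.symm h, Finsupp.mem_support_iff.mpr hne⟩)
    omega

theorem coeff_single_ne_zero_of_mem_vars {p : MvPolynomial σ K} (hp : p.totalDegree ≤ 1) {v : σ}
    (hv : v ∈ p.vars) : coeff (Finsupp.single v 1) p ≠ 0 := by
  obtain ⟨m, hm, hvm⟩ := (mem_vars_iff_mem_support v).mp hv
  rw [← eq_single_of_degree_le_one ((le_totalDegree hm).trans hp) hvm]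
  exact mem_support_iff.mp hm

theorem mem_span_range_X {p : MvPolynomial σ K} (hp : p.totalDegree ≤ 1)
    (h0 : constantCoeff p = 0) : p ∈ Submodule.span K (Set.range (X : σ → MvPolynomial σ K)) := by
  rw [p.as_sum]
  refine Submodule.sum_mem _ fun m hm => ?_
  have hm0 : m ≠ 0 := by
    rintro rfl
    exact mem_support_iff.mp hm h0
  obtain ⟨v, hv⟩ := Finsupp.support_nonempty_iff.mpr hm0
  have hmv := eq_single_of_degree_le_one ((le_totalDegree hm).trans hp) hv
  have : monomial m (coeff m p) = coeff m p • X v := by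
    rw [hmv, X, smul_monomial, smul_eq_mul, mul_one]
  rw [this]
  exact Submodule.smul_mem _ _ (Submodule.subset_span ⟨v, rfl⟩)

theorem degreeOf_eq_zero_iff_notMem_vars {p : MvPolynomial σ K} {v : σ} :
    p.degreeOf v = 0 ↔ v ∉ p.vars := by
  classical
  rw [degreeOf_def, vars_def, Multiset.mem_toFinset, Multiset.count_eq_zero]

theorem degreeOf_eq_one {p : MvPolynomial σ K} (hp : p.totalDegree ≤ 1) {v : σ}
    (hv : v ∈ p.vars) : p.degreeOf v = 1 := by
  refine le_antisymm ((degreeOf_le_totalDegree p v).trans hp) ?_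
  exact Nat.one_le_iff_ne_zero.mpr fun h => degreeOf_eq_zero_iff_notMem_vars.mp h hv

theorem irreducible_of_totalDegree_le_one {p : MvPolynomial σ K} (hp : p.totalDegree ≤ 1)
    (hv : p.vars.Nonempty) : Irreducible p := by
  obtain ⟨v, hv⟩ := hv
  refine irreducible_of_totalDegree_eq_one (le_antisymm hp ?_) fun x hx => ?_
  · rw [← degreeOf_eq_one hp hv]
    exact degreeOf_le_totalDegree p v
  · exact isUnit_iff_ne_zero.mpr fun h0 =>
      coeff_single_ne_zero_of_mem_vars hp hv (zero_dvd_iff.mp (h0 ▸ hx _))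

/-- Prescribe the values on the span of the independent family and extend to the whole space. -/
theorem exists_linearMap_apply_eq {ι V V' : Type*} [AddCommGroup V] [Module K V]
    [AddCommGroup V'] [Module K V'] {b : ι → V} (hb : LinearIndependent K b) (f : ι → V') :
    ∃ g : V →ₗ[K] V', ∀ i, g (b i) = f i := by
  obtain ⟨g, hg⟩ := LinearMap.exists_extend
    ((Finsupp.linearCombination K f).comp hb.repr)
  refine ⟨g, fun i => ?_⟩
  have hi : b i ∈ Submodule.span K (Set.range b) := Submodule.subset_span ⟨i, rfl⟩
  have := LinearMap.congr_fun hg ⟨b i, hi⟩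
  rw [LinearMap.comp_apply, Submodule.subtype_apply] at this
  rw [this, LinearMap.comp_apply, hb.repr_eq_single i _ rfl,
    Finsupp.linearCombination_single, one_smul]

end DegreeOne

/-! ### Elements of the implicit ideal that avoid the derivatives of a lead. -/

theorem diff_mem_span_range_X {Y K : Type*} [Field K] [Differential K] {p : DiffPoly Y K}
    (hp : p ∈ Submodule.span K (Set.range (X : Y × ℕ → DiffPoly Y K))) :
    diff p ∈ Submodule.span K (Set.range (X : Y × ℕ → DiffPoly Y K)) := by
  induction hp using Submodule.span_induction with
  | mem x hx =>
    obtain ⟨v, rfl⟩ := hx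
    rw [diff_X]
    exact Submodule.subset_span ⟨_, rfl⟩
  | zero =>
    rw [map_zero]
    exact Submodule.zero_mem _
  | add x y _ _ hx hy =>
    rw [map_add]
    exact Submodule.add_mem _ hx hy
  | smul c x hx hx' =>
    rw [smul_eq_C_mul, diff_C_mul, ← smul_eq_C_mul, ← smul_eq_C_mul]
    exact Submodule.add_mem _ (Submodule.smul_mem _ _ hx) (Submodule.smul_mem _ _ hx')

theorem op_sum {Y K ι : Type*} [Field K] [Differential K] (s : Finset ι)
    (q : ι → Polynomial K) : op Y (∑ i ∈ s, q i) = ∑ i ∈ s, op Y (q i) :=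
  map_sum (⟨⟨op Y, op_zero⟩, op_add⟩ : Polynomial K →+ AddMonoid.End (DiffPoly Y K)) _ _

theorem end_sum_apply {M ι : Type*} [AddCommMonoid M] (s : Finset ι) (f : ι → AddMonoid.End M)
    (x : M) : (∑ i ∈ s, f i) x = ∑ i ∈ s, f i x := AddMonoidHom.finsetSum_apply f s x

/-- The derivatives of `v`, including `v` itself. -/
def derivs {Y : Type*} (v : Y × ℕ) : Set (Y × ℕ) := {w | ∃ k, w = (v.1, v.2 + k)}

namespace DPPESystem

variable {n : ℕ} {K : Type*} [Field K] [Differential K] (E : DPPESystem n K)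

theorem iterate_diff_H_mem_span (i : Fin n) (k : ℕ) :
    diff^[k] (E.H i) ∈
      Submodule.span K (Set.range (X : Fin (n - 1) × ℕ → DiffPoly (Fin (n - 1)) K)) := by
  induction k with
  | zero =>
    refine mem_span_range_X ((totalDegree_sub_C_le _ _).trans (E.degree_le i)) ?_
    change constantCoeff (E.P i - C (constantCoeff (E.P i))) = 0
    rw [map_sub, constantCoeff_C, sub_self]
  | succ k ih =>
    rw [Function.iterate_succ_apply']
    exact diff_mem_span_range_X ih

/-- If `a` generates the relations and its component `v.1` has order `v.2`, then the derivatives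
of the homogeneous parts that do not correspond to derivatives of `v` are linearly independent. -/
theorem linearIndependent_iterate_diff_H {a : Fin n → Polynomial K}
    (hgen : ∀ t, E.IsRelation t → ∃ Q, t = fun i => LinearDPPE.opMul Q (a i)) {v : Fin n × ℕ}
    (hv : (a v.1).coeff v.2 ≠ 0) (hv' : ∀ k, v.2 < k → (a v.1).coeff k = 0) :
    LinearIndependent K fun w : ((derivs v)ᶜ : Set (Fin n × ℕ)) =>
      diff^[w.1.2] (E.H w.1.1) := by
  classical
  rw [linearIndependent_iff]
  intro l hl
  set t : Fin n → Polynomial K := fun i => ∑ w ∈ l.support,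
    if w.1.1 = i then Polynomial.monomial w.1.2 (l w) else 0 with htdef
  have hcoeff : ∀ i k, (t i).coeff k =
      ∑ w ∈ l.support, if w.1 = (i, k) then l w else 0 := by
    intro i k
    rw [htdef, Polynomial.finsetSum_coeff]
    refine Finset.sum_congr rfl fun w _ => ?_
    by_cases h : w.1.1 = i <;> simp [h, Prod.ext_iff, Polynomial.coeff_monomial]
  have ht : E.IsRelation t := by
    rw [IsRelation, ← hl, Finsupp.linearCombination_apply, Finsupp.sum]
    simp only [htdef, op_sum, end_sum_apply]
    rw [Finset.sum_comm]
    refine Finset.sum_congr rfl fun w _ => ?_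
    rw [Finset.sum_eq_single w.1.1]
    · rw [if_pos rfl, op_monomial, end_mul_apply, mulEnd_apply, diffEnd_pow_apply, smul_eq_C_mul]
    · intro i _ hi
      rw [if_neg hi.symm, op_zero]
      rfl
    · simp
  obtain ⟨Q, hQ⟩ := hgen t ht
  -- For `Q ≠ 0`, component `v.1` of `Q a` has a nonzero coefficient at `v.2 + Q.natDegree`, the
  -- index of a derivative of `v`; but `t` is supported off these.
  have hQ0 : Q = 0 := by
    by_contra hne
    have h1 := coeff_opMul hv' Q
    rw [← congrFun hQ v.1, hcoeff] at h1
    refine mul_ne_zero (Polynomial.leadingCoeff_ne_zero.mpr hne) hv ?_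
    rw [← h1]
    refine Finset.sum_eq_zero fun w _ => if_neg fun h => w.2 ⟨Q.natDegree, h⟩
  ext w
  have h2 := hcoeff w.1.1 w.1.2
  rw [congrFun hQ, hQ0, opMul_zero_left, Polynomial.coeff_zero, Finset.sum_eq_single w] at h2
  · rw [if_pos rfl] at h2
    exact h2.symm
  · intro u _ hu
    exact if_neg fun h => hu (Subtype.ext h)
  · intro h
    rw [Finsupp.notMem_support_iff.mp h, ite_self]

/-- Under the same hypotheses, a nonzero element of `ID` involves some derivative of `v`. -/
theorem eq_zero_of_mem_implicitIdeal {a : Fin n → Polynomial K}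
    (hgen : ∀ t, E.IsRelation t → ∃ Q, t = fun i => LinearDPPE.opMul Q (a i)) {v : Fin n × ℕ}
    (hv : (a v.1).coeff v.2 ≠ 0) (hv' : ∀ k, v.2 < k → (a v.1).coeff k = 0)
    {f : DiffPoly (Fin n) K} (hf : f ∈ E.implicitIdeal) (hfv : ∀ w ∈ f.vars, w ∉ derivs v) :
    f = 0 := by
  obtain ⟨g, hg⟩ := exists_linearMap_apply_eq (E.linearIndependent_iterate_diff_H hgen hv hv')
    fun w => (X w.1 - C (Differential.deriv^[w.1.2] (E.a w.1.1)) : DiffPoly (Fin n) K)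
  -- The algebra map `ψ` agrees with `g` on linear forms and undoes `E.subst` on each variable
  -- outside `derivs v`. It need not commute with `∂`.
  set ψ : DiffPoly (Fin (n - 1)) K →ₐ[K] DiffPoly (Fin n) K := aeval fun s => g (X s) with hψ
  have hψg : ∀ p ∈ Submodule.span K
      (Set.range (X : Fin (n - 1) × ℕ → DiffPoly (Fin (n - 1)) K)), ψ p = g p := by
    intro p hp
    refine LinearMap.eqOn_span (f := ψ.toLinearMap) (g := g) ?_ hp
    rintro _ ⟨s, rfl⟩
    exact aeval_X _ _
  have hψX : ∀ w ∉ derivs v, ψ (E.subst (X w)) = X w := by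
    intro w hw
    have hP : diff^[w.2] (E.P w.1) =
        diff^[w.2] (E.H w.1) + C (Differential.deriv^[w.2] (E.a w.1)) := by
      rw [← iterate_diff_C, ← iterate_diff_add, H, sub_add_cancel]
    rw [subst_X, hP, map_add, hψg _ (E.iterate_diff_H_mem_span _ _), hg ⟨w, hw⟩,
      show ψ (C _) = C _ from ψ.commutes _, sub_add_cancel]
  have hfix : ψ (E.subst f) = f := by
    have := hom_congr_vars (f₁ := (ψ.comp E.subst : _ →+* DiffPoly (Fin n) K))
      (f₂ := RingHom.id _) (p₁ := f) (p₂ := f) ?_ (fun w hw _ => hψX w (hfv w hw)) rfl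
    · exact this
    · ext1 c
      exact (ψ.comp E.subst).commutes c
  rw [← hfix, show E.subst f = 0 from hf, map_zero]

end DPPESystem

/-! ### Characteristic sets -/

section CharacteristicSets

variable {Y K : Type*} [Field K] {r : Y × ℕ → Y × ℕ → Prop}

theorem IsRanking.eq_or_lt_deriv (hr : IsRanking r) (v : Y × ℕ) (k : ℕ) :
    (v.1, v.2 + k) = v ∨ r v (v.1, v.2 + k) := by
  induction k with
  | zero => exact Or.inl rfl
  | succ k ih =>
    right
    have h := hr.lt_deriv (v.1, v.2 + k)
    rcases ih with ih | ih
    · have h' := hr.lt_deriv v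
      have hk : v.2 + k = v.2 := congrArg Prod.snd ih
      rw [← add_assoc, hk]
      exact h'
    · exact hr.trans _ _ _ ih h

theorem IsRanking.lt_deriv_of_pos (hr : IsRanking r) (v : Y × ℕ) {k : ℕ} (hk : 0 < k) :
    r v (v.1, v.2 + k) := by
  rcases hr.eq_or_lt_deriv v k with h | h
  · have := congrArg Prod.snd h
    simp only at this
    omega
  · exact h

theorem IsRanking.exists_isLead (hr : IsRanking r) {p : DiffPoly Y K} (hp : p.vars.Nonempty) :
    ∃ v, IsLead r p v := by
  have : ∀ s : Finset (Y × ℕ), s.Nonempty → ∃ v ∈ s, ∀ w ∈ s, w ≠ v → r w v := by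
    intro s hs
    induction hs using Finset.Nonempty.cons_induction with
    | singleton a => exact ⟨a, by simp, by simp⟩
    | cons a s ha _ ih =>
      obtain ⟨v, hv, hmax⟩ := ih
      rcases hr.total a v with h | rfl | h
      · refine ⟨v, Finset.mem_cons_of_mem hv, fun w hw hne => ?_⟩
        rcases Finset.mem_cons.mp hw with rfl | hw
        · exact h
        · exact hmax w hw hne
      · exact absurd hv ha
      · refine ⟨a, Finset.mem_cons_self a s, fun w hw hne => ?_⟩
        rcases Finset.mem_cons.mp hw with rfl | hw
        · exact absurd rfl hne
        · by_cases hwv : w = v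
          · exact hwv ▸ h
          · exact hr.trans _ _ _ (hmax w hw hwv) h
  exact this _ hp

theorem IsLead.eq_or_lt {p : DiffPoly Y K} {v w : Y × ℕ} (h : IsLead r p v) (hw : w ∈ p.vars) :
    w = v ∨ r w v := by
  by_cases hwv : w = v
  · exact Or.inl hwv
  · exact Or.inr (h.2 w hw hwv)

theorem IsRanking.lead_unique (hr : IsRanking r) {p : DiffPoly Y K} {v w : Y × ℕ}
    (hv : IsLead r p v) (hw : IsLead r p w) : v = w := by
  by_contra hne
  exact hr.irrefl _ (hr.trans _ _ _ (hw.2 v hv.1 hne) (hv.2 w hw.1 (Ne.symm hne)))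

theorem notMem_vars_derivs_of_isReduced (hr : IsRanking r) {p q : DiffPoly Y K} {v : Y × ℕ}
    (hv : IsLead r p v) (hd : p.degreeOf v ≤ 1) (hq : IsReduced r q p) :
    ∀ w ∈ q.vars, w ∉ derivs v := by
  obtain ⟨u, hu, hder, hdeg⟩ := hq
  obtain rfl := hr.lead_unique hu hv
  rintro _ hw ⟨k, rfl⟩
  rcases Nat.eq_zero_or_pos k with rfl | hk
  · have h0 : q.degreeOf u = 0 := by omega
    exact degreeOf_eq_zero_iff_notMem_vars.mp h0 hw
  · exact hder k hk hw

theorem isReduced_of_notMem_vars_derivs {p q : DiffPoly Y K} {v : Y × ℕ} (hv : IsLead r p v)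
    (hq : ∀ w ∈ q.vars, w ∉ derivs v) : IsReduced r q p := by
  refine ⟨v, hv, fun k _ hk => hq _ hk ⟨k, rfl⟩, ?_⟩
  rw [degreeOf_eq_zero_iff_notMem_vars.mpr fun h => hq v h ⟨0, rfl⟩]
  exact Nat.pos_of_ne_zero fun h => degreeOf_eq_zero_iff_notMem_vars.mp h hv.1

/-- If every nonzero element of an ideal involves a derivative of the lead of a linear element
`A`, then `{A}` is a characteristic set. -/
theorem isCharacteristicSet_singleton (hr : IsRanking r) {I : Ideal (DiffPoly Y K)}
    {A : DiffPoly Y K} (hA : A ∈ I) {v : Y × ℕ} (hv : IsLead r A v) (hd : A.degreeOf v ≤ 1)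
    (hI : ∀ f ∈ I, (∀ w ∈ f.vars, w ∉ derivs v) → f = 0) :
    IsCharacteristicSet r I {A} := by
  refine ⟨?_, ?_, fun f hf hf0 hred => hf0 ?_⟩
  · rintro p rfl
    exact ⟨hA, _, hv.1⟩
  · rintro p rfl q rfl h
    exact absurd rfl h
  · exact hI f hf (notMem_vars_derivs_of_isReduced hr hv hd (hred A rfl))

/-- Under the same hypotheses, all characteristic sets have exactly one element. -/
theorem IsCharacteristicSet.encard_eq_one (hr : IsRanking r) {I : Ideal (DiffPoly Y K)}
    {A : DiffPoly Y K} (hA : A ∈ I) {v : Y × ℕ} (hv : IsLead r A v) (hd : A.degreeOf v ≤ 1)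
    (hI : ∀ f ∈ I, (∀ w ∈ f.vars, w ∉ derivs v) → f = 0) {S : Set (DiffPoly Y K)}
    (hS : IsCharacteristicSet r I S) : S.encard = 1 := by
  obtain ⟨hSI, hauto, hred⟩ := hS
  have hA0 : A ≠ 0 := by
    rintro rfl
    simpa using hv.1
  have hne0 : ∀ p ∈ S, p ≠ 0 := by
    rintro p hp rfl
    simpa using (hSI _ hp).2
  obtain ⟨p, hp, hpA⟩ : ∃ p ∈ S, ¬ IsReduced r A p := by
    by_contra! h
    exact hred A hA hA0 h
  obtain ⟨u, hu⟩ := hr.exists_isLead (hSI p hp).2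
  -- If `u` were above `v`, no derivative of `u` could occur in `A`, and `A` would be reduced with
  -- respect to `p`.
  have hle : u = v ∨ r u v := by
    by_contra hcon
    refine hpA (isReduced_of_notMem_vars_derivs hu ?_)
    rintro w hw ⟨k, rfl⟩
    rcases hv.eq_or_lt hw with h | h <;> rcases hr.eq_or_lt_deriv u k with h' | h'
    · exact hcon (Or.inl (h'.symm.trans h))
    · exact hcon (Or.inr (h ▸ h'))
    · exact hcon (Or.inr (h' ▸ h))
    · exact hcon (Or.inr (hr.trans _ _ _ h' h))
  -- As a nonzero element of `I`, `p` involves a derivative of `v`, and this is at most the lead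
  -- `u`.
  have hge : v = u ∨ r v u := by
    by_contra hcon
    refine hne0 p hp (hI p (hSI p hp).1 ?_)
    rintro w hw ⟨k, rfl⟩
    rcases hu.eq_or_lt hw with h | h <;> rcases hr.eq_or_lt_deriv v k with h' | h'
    · exact hcon (Or.inl (h'.symm.trans h))
    · exact hcon (Or.inr (h ▸ h'))
    · exact hcon (Or.inr (h' ▸ h))
    · exact hcon (Or.inr (hr.trans _ _ _ h' h))
  have huv : u = v := by
    rcases hle with h | h
    · exact h
    · rcases hge with h' | h'
      · exact h'.symm
      · exact absurd (hr.trans _ _ _ h h') (hr.irrefl _)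
  subst huv
  -- Otherwise `A`, of degree at most one in the common lead, would be reduced with respect to `p`.
  have hpd : p.degreeOf u ≤ 1 := by
    by_contra hlt
    refine hpA ⟨u, hu, fun k hk hmem => ?_, by omega⟩
    have h := hr.lt_deriv_of_pos u hk
    rcases hv.eq_or_lt hmem with h' | h'
    · rw [h'] at h
      exact hr.irrefl _ h
    · exact hr.irrefl _ (hr.trans _ _ _ h h')
  rw [Set.encard_eq_one]
  -- Any other element is reduced with respect to `p`, hence free of the derivatives of the lead,
  -- hence zero.
  refine ⟨p, Set.eq_singleton_iff_unique_mem.mpr ⟨hp, fun q hq => ?_⟩⟩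
  by_contra hqp
  exact hne0 q hq (hI q (hSI q hq).1
    (notMem_vars_derivs_of_isReduced hr hu hpd (hauto p hp q hq hqp)))

end CharacteristicSets

end LinearDPPE

end

/-! ### The main theorem. -/

open LinearDPPE in
theorem mainTheorem4 {n : ℕ} {K : Type*} [Field K] [Differential K] (E : DPPESystem n K)
    (hS : E.S.rank = n - 1)
    (𝒢 : Set (DiffPoly (Fin n ⊕ Fin (n - 1)) K)) (h𝒢 : E.IsGroebnerBasis 𝒢)
    (A : DiffPoly (Fin n) K) (hA0 : A ≠ 0) (hAlin : A.totalDegree ≤ 1)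
    (hAprim : E.IsIDPrimitive A)
    (hAmem : A ∈ idealIn E.varsX (DPPESystem.interX 𝒢))
    (hcard : (DPPESystem.interX 𝒢).ncard = E.coorder (DPPESystem.inclX A) + 1)
    (r : Fin n × ℕ → Fin n × ℕ → Prop) (hr : IsRanking r) :
    IsCharacteristicPolynomial r E.implicitIdeal A ∧
      HasDimension r E.implicitIdeal (n - 1) := by
  have hAI : A ∈ E.implicitIdeal := hAprim.1
  obtain ⟨a, hAa, hgen⟩ := hAprim.exists_eq_linForm E hS hA0
  have hvars : A.vars.Nonempty := by
    rw [Finset.nonempty_iff_ne_empty]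
    intro h
    have hc := MvPolynomial.vars_eq_empty_iff_eq_C.mp h
    have h0 : E.subst A = 0 := hAI
    rw [hc, E.subst_C, MvPolynomial.C_eq_zero] at h0
    exact hA0 (by rw [hc, h0, map_zero])
  obtain ⟨v, hv⟩ := hr.exists_isLead hvars
  have hcoeff : ∀ w, (a w.1).coeff w.2 = A.coeff (Finsupp.single w 1) := fun w => by
    rw [hAa, E.coeff_linForm]
  have hv1 : (a v.1).coeff v.2 ≠ 0 := by
    rw [hcoeff]
    exact coeff_single_ne_zero_of_mem_vars hAlin hv.1
  -- A higher coefficient in component `v.1` would put into `A` a proper derivative of its lead.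
  have hv2 : ∀ k, v.2 < k → (a v.1).coeff k = 0 := by
    intro k hk
    by_contra hne
    have hmem : (v.1, k) ∈ A.vars := by
      rw [hcoeff (v.1, k)] at hne
      exact (MvPolynomial.mem_vars_iff_mem_support _).mpr
        ⟨_, MvPolynomial.mem_support_iff.mpr hne, by simp⟩
    have hlt := hr.lt_deriv_of_pos v (Nat.sub_pos_of_lt hk)
    rw [Nat.add_sub_cancel' hk.le] at hlt
    rcases hv.eq_or_lt hmem with h | h
    · rw [h] at hlt
      exact hr.irrefl _ hlt
    · exact hr.irrefl _ (hr.trans _ _ _ h hlt)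
  have hI : ∀ f ∈ E.implicitIdeal, (∀ w ∈ f.vars, w ∉ derivs v) → f = 0 :=
    fun f hf => E.eq_zero_of_mem_implicitIdeal hgen hv1 hv2 hf
  have hd : A.degreeOf v ≤ 1 := (degreeOf_eq_one hAlin hv.1).le
  have hchar := isCharacteristicSet_singleton hr hAI hv hd hI
  refine ⟨⟨irreducible_of_totalDegree_le_one hAlin hvars, hchar⟩, ⟨_, hchar⟩, fun S hS' => ?_⟩
  rw [hS'.encard_eq_one hr hAI hv hd hI, Fintype.card_fin]
  have hn : 0 < n := v.1.pos
  exact_mod_cast (by omega : 1 + (n - 1) = n)
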